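/- Conventions. For integers $n,k>0$ and $m\ge 0$ let $\mathsf{matr}(n,m,k)$ be the set of $n\times m$ matrices with entries in $\{0,\dots,k-1\}$. A \emph{matrix set} is a set of such matrices, of possibly different sizes $(n,m,k)$. Let $M=[a_{ij}]\in\mathsf{matr}(n,m,k)$. (Relations on sets.) An $n$-ary relation $R\subseteq X^n$ on a set $X$ is \emph{strictly $M$-closed} if for all functions $f_1,\dots,f_n\colon\{0,\dots,k-1\}\to X$: whenever $(f_1(a_{1j}),\dots,f_n(a_{nj}))\in R$ for every $j\in\{1,\dots,m\}$, then $(f_1(0),\dots,f_n(0))\in R$. It is \emph{$M$-closed} if this holds whenever $f_1=\dots=f_n$. For $n'>0$, an $n'$-ary relation on a set is \emph{$M$-sharp} if it is strictly $M'$-closed for every $M'\in\mathsf{matr}(n',m,k)$ each of whose rows is a row of $M$. (Relations in categories.) An \emph{internal $n$-ary relation} on an object $C$ of a category $\mathbb{C}$ is an object $R$ with morphisms $r_1,\dots,r_n\colon R\to C$ that are jointly monomorphic (if $r_ix=r_iy$ for all $i$, then $x=y$). It is \emph{$M$-closed} if for every object $X$ and every function $f\colon\{0,\dots,k-1\}\to\mathbb{C}(X,C)$: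 whenever for each $j\in\{1,\dots,m\}$ there is $u_j\colon X\to R$ with $r_iu_j=f(a_{ij})$ for all $i$, then there is $v\colon X\to R$ with $r_iv=f(0)$ for all $i$. The category $\mathbb{C}$ \emph{has $M$-closed relations} if every internal $n$-ary relation on every object of $\mathbb{C}$ is $M$-closed. A category is \emph{left exact} if it has all finite limits. For a matrix set $S$, $\mathsf{mclex}\,S$ denotes the collection of all left exact categories that have $M$-closed relations for every $M\in S$. The matrix $M$ is \emph{trivial} if every left exact category with $M$-closed relations is a preorder, i.e. any two parallel morphisms in it are equal. Theorem. Let $S$ and $U$ be matrix sets. Consider the condition $(*)$ for every integer $n>0$, every $n$-ary relation on any set that is $M$-sharp for every $M\in S$ is $N$-closed for every matrix $N\in U$ having exactly $n$ rows. If $(*)$ holds, then every left exact category that has $M$-closed relations for every $M\in S$ also has $N$-closed relations for every $N\in U$, i.e. $\mathsf{mclex}\,S\subseteq\mathsf{mclex}\,U$. Conversely, if no matrix in $S$ is trivial and $\mathsf{mclex}\,S\subseteq\mathsf{mclex}\,U$, then $(*)$ holds. -/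

import Mathlib

open CategoryTheory CategoryTheory.Limits

universe w v u

/-- `Matr n m k` is the type of `n × m` matrices with entries in `{0, …, k - 1}`. -/
abbrev Matr (n m k : ℕ) : Type := Matrix (Fin n) (Fin m) (Fin k)

/-- A matrix of unspecified size: an element of `Matr n m k` for some `n > 0`, `m ≥ 0`, `k > 0`. -/
structure SizedMatr where
  {n : ℕ}
  {m : ℕ}
  {k : ℕ}
  [n_ne : NeZero n]
  [k_ne : NeZero k]
  mat : Matr n m k

attribute [instance] SizedMatr.n_ne SizedMatr.k_ne

/-- A matrix set. -/
abbrev MatrixSet : Type := Set SizedMatr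

namespace Matr

variable {n m k : ℕ}

/-- The `j`-th left column of the row-wise interpretation of `M` given by functions
`f i : {0, …, k - 1} → S i`. -/
def leftColumn (M : Matr n m k) {S : Fin n → Type w} (f : ∀ i, Fin k → S i) (j : Fin m) :
    ∀ i, S i :=
  fun i => f i (M i j)

/-- The right column of the row-wise interpretation given by functions
`f i : {0, …, k - 1} → S i`. -/
def rightColumn [NeZero k] {S : Fin n → Type w} (f : ∀ i, Fin k → S i) : ∀ i, S i :=
  fun i => f i 0

/-- An ordinary `n`-ary relation `R` between sets `S 0, …, S (n - 1)` is strictly `M`-closed: for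
every row-wise interpretation of `M`, if all left columns are in `R`, so is the right column. -/
def StrictlyClosed [NeZero k] (M : Matr n m k) {S : Fin n → Type w} (R : Set (∀ i, S i)) : Prop :=
  ∀ f : ∀ i, Fin k → S i, (∀ j, M.leftColumn f j ∈ R) → rightColumn f ∈ R

/-- An ordinary `n`-ary relation `R` on a set `X` is `M`-closed: as for strict closedness, but only
for interpretations in which the same function `f` is used in every row. -/
def Closed [NeZero k] (M : Matr n m k) {X : Type w} (R : Set (Fin n → X)) : Prop :=
  ∀ f : Fin k → X, (∀ j, M.leftColumn (fun _ => f) j ∈ R) → rightColumn (fun _ => f) ∈ R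

/-- An ordinary `n'`-ary relation `R` on a set `X` is `M`-sharp, where `n'` need not be the number
of rows of `M`: it is strictly `M'`-closed for every matrix `M'` with `n'` rows each of which is a
row of `M`. -/
def Sharp [NeZero k] (M : Matr n m k) {n' : ℕ} {X : Type w} (R : Set (Fin n' → X)) : Prop :=
  ∀ M' : Matr n' m k, (∀ i', ∃ i, M' i' = M i) → M'.StrictlyClosed R

end Matr

/-- An internal `n`-ary relation on an object `A` of a category: an object `obj` with a jointly
monomorphic family of `n` morphisms to `A`. -/
structure InternalRel {C : Type u} [Category.{v} C] (n : ℕ) (A : C) where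
  obj : C
  r : Fin n → (obj ⟶ A)
  jointly_mono : ∀ {X : C} (x y : X ⟶ obj), (∀ i, x ≫ r i = y ≫ r i) → x = y

namespace InternalRel

variable {C : Type u} [Category.{v} C] {n m k : ℕ} {A : C}

/-- The column `c` of morphisms `X ⟶ A` factors through the relation. -/
def Factors (ρ : InternalRel n A) {X : C} (c : Fin n → (X ⟶ A)) : Prop :=
  ∃ u : X ⟶ ρ.obj, ∀ i, c i = u ≫ ρ.r i

/-- The internal relation `ρ` on `A` is `M`-closed over `X`: it is compatible with every
interpretation of `M` of type `X ⟶ A`. -/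
def ClosedOver [NeZero k] (ρ : InternalRel n A) (M : Matr n m k) (X : C) : Prop :=
  ∀ f : Fin k → (X ⟶ A),
    (∀ j, ρ.Factors (M.leftColumn (fun _ => f) j)) → ρ.Factors (Matr.rightColumn (fun _ => f))

end InternalRel

/-- The category `C` has `M`-closed relations. -/
def HasClosedRelations (C : Type u) [Category.{v} C] (M : SizedMatr) : Prop :=
  ∀ (A : C) (ρ : InternalRel M.n A) (X : C), ρ.ClosedOver M.mat X

/-- `mclex S`: the collection of all left exact (that is, finitely complete) categories which have
`M`-closed relations for every `M` in `S`. -/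
def mclex (S : MatrixSet) : Set Cat.{v, u} :=
  {C | HasFiniteLimits C ∧ ∀ M ∈ S, HasClosedRelations C M}

/-- `M` is trivial: every left exact category with `M`-closed relations is a preorder, i.e. any two
parallel morphisms in it coincide. -/
def IsTrivialMatr (M : SizedMatr) : Prop :=
  ∀ C ∈ mclex.{v, u} {M}, ∀ (X Y : C) (x y : X ⟶ Y), x = y

/-- For every `n > 0`, every `n`-ary relation on any set which is `M`-sharp for all `M ∈ S` is
`N`-closed for all matrices `N ∈ U` having `n` rows. -/
def SharpImpliesClosed (S U : MatrixSet) : Prop :=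
  ∀ (n : ℕ) [NeZero n] (X : Type w) (R : Set (Fin n → X)),
    (∀ M ∈ S, M.mat.Sharp R) →
      ∀ (m k : ℕ) [NeZero k] (N : Matr n m k), SizedMatr.mk N ∈ U → N.Closed R

namespace Matr

variable {n m k : ℕ}

/-! For fixed X, factoring through an internal relation on A defines an ordinary relation on Hom(X,
A). In a left exact category with M-closed relations it is M-sharp (`sharp_factors`), which gives
the first implication.

For the converse, the finite sets with an n-ary relation that is M-sharp for all M in S form a
category with finite colimits, so its opposite is left exact. For nontrivial M in S the opposite has
M-closed relations (`hasClosedRelations_op`). It also carries a generic internal relation that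
recovers the relation of each structure (`factors_genericRel`), so its N-closedness makes all these
finite relations N-closed. Finite sets suffice, since an interpretation of N involves only k
elements. -/

theorem Sharp.preimage [NeZero k] {M : Matr n m k} {n' : ℕ} {X : Type*} {Y : Type*}
    {R : Set (Fin n' → Y)} (hR : M.Sharp R) (h : X → Y) :
    M.Sharp {c : Fin n' → X | h ∘ c ∈ R} :=
  fun M' hM' f hf => hR M' hM' (fun i => h ∘ f i) hf

theorem sharp_univ [NeZero k] (M : Matr n m k) {n' : ℕ} {X : Type*} :
    M.Sharp (Set.univ : Set (Fin n' → X)) :=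
  fun _ _ _ _ => trivial

end Matr

/-! ### Sharpness of internal relations -/

namespace InternalRel

variable {C : Type u} [Category.{v} C]

/-- The columns of morphisms `X ⟶ A` which factor through an internal relation on `A` form an
ordinary relation on `X ⟶ A`, which is `M`-sharp if the category has `M`-closed relations. -/
theorem sharp_factors [HasFiniteLimits C] {M : SizedMatr} (hM : HasClosedRelations C M)
    {n' : ℕ} {A : C} (ρ : InternalRel n' A) (X : C) :
    M.mat.Sharp {c : Fin n' → (X ⟶ A) | ρ.Factors c} := by
  intro M' hM' f hf
  choose σ hσ using hM'
  -- A morphism to the power B of A packages the n' different functions of a strict interpretation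
  -- into one. The relation τ is ρ pulled back along p, which reads coordinate i' from component σ
  -- i'; M-closedness of τ then gives strict M'-closedness.
  let B : C := ∏ᶜ fun _ : Fin n' => A
  let p : (∏ᶜ fun _ : Fin M.n => B) ⟶ B :=
    Pi.lift fun i' => Pi.π (fun _ : Fin M.n => B) (σ i') ≫ Pi.π (fun _ : Fin n' => A) i'
  let τ : InternalRel M.n B :=
    { obj := pullback p (Pi.lift ρ.r)
      r := fun i => pullback.fst p (Pi.lift ρ.r) ≫ Pi.π (fun _ : Fin M.n => B) i
      jointly_mono := by
        intro Z x y h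
        have h₁ : x ≫ pullback.fst p (Pi.lift ρ.r) = y ≫ pullback.fst p (Pi.lift ρ.r) :=
          Pi.hom_ext _ _ fun i => by simpa using h i
        refine pullback.hom_ext h₁ (ρ.jointly_mono _ _ fun i => ?_)
        have h₂ : ∀ z : Z ⟶ pullback p (Pi.lift ρ.r),
            (z ≫ pullback.snd p (Pi.lift ρ.r)) ≫ ρ.r i =
              (z ≫ pullback.fst p (Pi.lift ρ.r)) ≫ p ≫ Pi.π (fun _ : Fin n' => A) i := by
          intro z
          rw [Category.assoc, Category.assoc, ← Category.assoc _ p, pullback.condition,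
            Category.assoc, Pi.lift_π]
        rw [h₂, h₂, h₁] }
  have hτ : ∀ c : Fin M.n → (X ⟶ B),
      τ.Factors c ↔ ρ.Factors fun i' => c (σ i') ≫ Pi.π (fun _ : Fin n' => A) i' := by
    intro c
    constructor
    · rintro ⟨u, hu⟩
      refine ⟨u ≫ pullback.snd p (Pi.lift ρ.r), fun i' => ?_⟩
      have h := congrArg (fun t => t ≫ Pi.π (fun _ : Fin n' => A) i')
        (pullback.condition (f := p) (g := Pi.lift ρ.r))
      simp only [p, Category.assoc, Pi.lift_π] at h
      simp only [hu, τ, Category.assoc, ← h, p]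
    · rintro ⟨u, hu⟩
      refine ⟨pullback.lift (Pi.lift c) u (Pi.hom_ext _ _ fun i' => ?_), fun i => ?_⟩
      · simp only [p, Category.assoc, Pi.lift_π, Pi.lift_π_assoc]
        exact hu i'
      · simp only [τ, pullback.lift_fst_assoc, Pi.lift_π]
  let g : Fin M.k → (X ⟶ B) := fun a => Pi.lift fun i' => f i' a
  have hg : ∀ a : Fin n' → Fin M.k,
      (fun i' => g (a i') ≫ Pi.π (fun _ : Fin n' => A) i') = fun i' => f i' (a i') :=
    fun a => funext fun i' => Pi.lift_π _ _
  have h := (hτ _).1 <| hM B τ X g fun j => (hτ _).2 <| by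
    refine (congrArg ρ.Factors (hg fun i' => M.mat (σ i') j)).mpr ?_
    simp only [← hσ]
    exact hf j
  exact (congrArg ρ.Factors (hg fun _ => 0)).mp h

/-- The diagonal, as an internal binary relation. -/
def diagonal (A : C) : InternalRel 2 A where
  obj := A
  r _ := 𝟙 A
  jointly_mono x y h := by simpa using h 0

end InternalRel

theorem mclex_subset_of_sharpImpliesClosed {S U : MatrixSet} (h : SharpImpliesClosed.{w} S U) :
    mclex.{v, u} S ⊆ mclex.{v, u} U := by
  rintro C ⟨hC, hS⟩
  refine ⟨hC, fun N hN A ρ X f hf => ?_⟩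
  -- Pulling back along f moves the relation to the entries of N, which fit into any universe.
  exact h N.n (ULift.{w} (Fin N.k))
    {c | (f ∘ ULift.down) ∘ c ∈ {c : Fin N.n → (X ⟶ A) | ρ.Factors c}}
    (fun M hM => (ρ.sharp_factors (hS M hM) X).preimage _) N.m N.k N.mat hN ULift.up hf

/-- Two rows of a non-trivial matrix, interpreted by functions which identify their entries in
every column, give the same value at `0`. -/
theorem eq_zero_of_not_isTrivialMatr {M : SizedMatr} (hM : ¬ IsTrivialMatr.{v, u} M)
    (i i' : Fin M.n) {T : Type*} (g g' : Fin M.k → T)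
    (h : ∀ j, g (M.mat i j) = g' (M.mat i' j)) : g 0 = g' 0 := by
  classical
  by_contra hne
  refine hM fun C hC X Y x y => ?_
  obtain ⟨_, hC⟩ := hC
  -- Send the value g 0 to x and all other values to y: the left columns lie on the diagonal, and
  -- the right column is (x, y).
  have hs := (InternalRel.diagonal Y).sharp_factors (hC M rfl) X
    (fun l => M.mat (![i, i'] l)) (fun l => ⟨_, rfl⟩)
    (fun l a => if ![g, g'] l a = g 0 then x else y)
    (fun j => ⟨if g (M.mat i j) = g 0 then x else y, fun l => by
      fin_cases l <;> simp [Matr.leftColumn, InternalRel.diagonal, h]⟩)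
  obtain ⟨t, ht⟩ := hs
  have h₀ := ht 0
  have h₁ := ht 1
  simp [Matr.rightColumn, InternalRel.diagonal, Ne.symm hne] at h₀ h₁
  rw [h₀, h₁]

/-- The smallest relation containing `R` which is `M`-sharp for all `M ∈ S`. -/
def sharpClosure (S : MatrixSet) {n : ℕ} {X : Type*} (R : Set (Fin n → X)) : Set (Fin n → X) :=
  {c | ∀ Q : Set (Fin n → X), R ⊆ Q → (∀ M ∈ S, M.mat.Sharp Q) → c ∈ Q}

section sharpClosure

variable {S : MatrixSet} {n : ℕ} {X : Type*}

theorem subset_sharpClosure (R : Set (Fin n → X)) : R ⊆ sharpClosure S R :=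
  fun _ hc _ hQ _ => hQ hc

theorem sharp_sharpClosure (R : Set (Fin n → X)) {M : SizedMatr} (hM : M ∈ S) :
    M.mat.Sharp (sharpClosure S R) :=
  fun M' hM' f hf Q hRQ hQ => hQ M hM M' hM' f fun j => hf j Q hRQ hQ

theorem comp_mem_of_mem_sharpClosure {Y : Type*} {R : Set (Fin n → X)} {Q : Set (Fin n → Y)}
    (hQ : ∀ M ∈ S, M.mat.Sharp Q) (h : X → Y) (hR : ∀ c ∈ R, h ∘ c ∈ Q) {c : Fin n → X}
    (hc : c ∈ sharpClosure S R) : h ∘ c ∈ Q :=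
  hc {c | h ∘ c ∈ Q} hR fun M hM => (hQ M hM).preimage h

end sharpClosure

/-! ### The category of finite sharp structures -/

/-- Finite sets `{0, …, size - 1}` with an `n`-ary relation which is `M`-sharp for all `M ∈ S`. -/
structure SharpStr (S : MatrixSet) (n : ℕ) : Type u where
  size : ℕ
  rel : Set (Fin n → Fin size)
  sharp : ∀ M ∈ S, M.mat.Sharp rel

namespace SharpStr

variable {S : MatrixSet} {n : ℕ}

/-- Relation preserving functions. -/
@[ext]
structure Hom (A B : SharpStr.{u} S n) : Type v where
  toFun : Fin A.size → Fin B.size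
  map_rel : ∀ c ∈ A.rel, toFun ∘ c ∈ B.rel

instance : Category.{v} (SharpStr.{u} S n) where
  Hom := Hom.{v}
  id A := ⟨id, fun _ hc => hc⟩
  comp f g := ⟨g.toFun ∘ f.toFun, fun c hc => g.map_rel _ (f.map_rel c hc)⟩

theorem hom_ext {A B : SharpStr.{u} S n} {f g : A ⟶ B}
    (h : Hom.toFun.{v} f = Hom.toFun.{v} g) : f = g :=
  Hom.ext h

/-- The structure freely generated by a relation. -/
def free (S : MatrixSet) {n : ℕ} (s : ℕ) (R : Set (Fin n → Fin s)) : SharpStr.{u} S n :=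
  ⟨s, sharpClosure S R, fun _ hM => sharp_sharpClosure R hM⟩

/-- Morphisms out of a free structure. -/
def free.desc {s : ℕ} {R : Set (Fin n → Fin s)} {B : SharpStr.{u} S n} (h : Fin s → Fin B.size)
    (hR : ∀ c ∈ R, h ∘ c ∈ B.rel) : Hom.{v} (free.{u} S s R) B :=
  ⟨h, fun _ hc => comp_mem_of_mem_sharpClosure B.sharp h hR hc⟩

/-! ### Finite colimits -/

section colimit

variable {J : Type} [SmallCategory J] (F : J ⥤ SharpStr.{u} S n)

/-- The colimit of the underlying sets. -/
def ColimitType : Type :=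
  Quot fun p q : Σ j, Fin (F.obj j).size => ∃ g : p.1 ⟶ q.1, q.2 = Hom.toFun.{v} (F.map g) p.2

/-- The coprojections to the colimit of the underlying sets. -/
def colimitMk (j : J) (x : Fin (F.obj j).size) : ColimitType.{v} F :=
  Quot.mk _ ⟨j, x⟩

theorem colimitMk_map {j j' : J} (g : j ⟶ j') (x : Fin (F.obj j).size) :
    colimitMk.{v} F j' (Hom.toFun.{v} (F.map g) x) = colimitMk.{v} F j x :=
  (Quot.sound ⟨g, rfl⟩).symm

instance [Finite J] : Finite (ColimitType.{v} F) :=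
  inferInstanceAs (Finite (Quot _))

variable [Finite J]

/-- An enumeration of the colimit of the underlying sets. -/
noncomputable def colimitEquiv : ColimitType.{v} F ≃ Fin (Nat.card (ColimitType.{v} F)) :=
  Finite.equivFin _

/-- The coprojections to the enumerated colimit. -/
noncomputable def colimitι (j : J) (x : Fin (F.obj j).size) :
    Fin (Nat.card (ColimitType.{v} F)) :=
  colimitEquiv.{v} F (colimitMk.{v} F j x)

/-- The colimit structure: it is freely generated by the images of the given relations. -/
noncomputable def colimitObj : SharpStr.{u} S n :=
  free S (Nat.card (ColimitType.{v} F)) {c | ∃ j, ∃ d ∈ (F.obj j).rel, c = colimitι.{v} F j ∘ d}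

/-- The coprojections, as morphisms. -/
noncomputable def colimitHom (j : J) : Hom.{v} (F.obj j) (colimitObj.{v} F) where
  toFun := colimitι.{v} F j
  map_rel d hd := subset_sharpClosure _ ⟨j, d, hd, rfl⟩

/-- The colimit cocone. -/
noncomputable def colimitCocone : Cocone F where
  pt := colimitObj.{v} F
  ι :=
    { app := colimitHom.{v} F
      naturality := fun _ _ g => hom_ext <| funext fun x =>
        congrArg (colimitEquiv.{v} F) (colimitMk_map.{v} F g x) }

/-- The universal property of the colimit of the underlying sets. -/
def colimitDesc (s : Cocone F) : ColimitType.{v} F → Fin s.pt.size :=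
  Quot.lift (fun p => Hom.toFun.{v} (s.ι.app p.1) p.2) (by
    rintro ⟨j, x⟩ ⟨j', y⟩ ⟨g, hg⟩
    dsimp only at g hg ⊢
    rw [hg, ← s.w g]
    rfl)

theorem colimitDesc_colimitι (s : Cocone F) (j : J) (x : Fin (F.obj j).size) :
    colimitDesc.{v} F s ((colimitEquiv.{v} F).symm (colimitι.{v} F j x)) =
      Hom.toFun.{v} (s.ι.app j) x := by
  rw [colimitι, Equiv.symm_apply_apply]
  rfl

/-- The universal property of the colimit, as a morphism. -/
noncomputable def colimitDescHom (s : Cocone F) : Hom.{v} (colimitObj.{v} F) s.pt :=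
  free.desc (colimitDesc.{v} F s ∘ (colimitEquiv.{v} F).symm) (by
    rintro _ ⟨j, d, hd, rfl⟩
    have h : (colimitDesc.{v} F s ∘ (colimitEquiv.{v} F).symm) ∘ colimitι.{v} F j ∘ d =
        Hom.toFun.{v} (s.ι.app j) ∘ d :=
      funext fun l => colimitDesc_colimitι F s j (d l)
    rw [h]
    exact Hom.map_rel.{v} (s.ι.app j) d hd)

/-- The colimit cocone is a colimit. -/
noncomputable def isColimitColimitCocone : IsColimit (colimitCocone.{v} F) where
  desc s := colimitDescHom.{v} F s
  fac s j := hom_ext <| funext fun x => colimitDesc_colimitι F s j x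
  uniq s t ht := hom_ext <| funext fun y => by
    obtain ⟨q, rfl⟩ := (colimitEquiv.{v} F).surjective (y : Fin (Nat.card (ColimitType.{v} F)))
    obtain ⟨j, x⟩ := q
    exact (congrFun (congrArg Hom.toFun.{v} (ht j)) x).trans (colimitDesc_colimitι F s j x).symm

end colimit

instance : HasFiniteColimits.{v, u} (SharpStr.{u} S n) where
  out _ _ _ := ⟨fun F => ⟨⟨_, isColimitColimitCocone.{v} F⟩⟩⟩

/-- In `SharpStr` the maps r i are jointly epic. Every function into the two-element structure with
the full relation is a morphism, so a missed element q could be separated from the rest. -/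
theorem exists_apply_eq {p : ℕ} {A : (SharpStr.{u} S n)ᵒᵖ} (ρ : InternalRel.{v, u} p A)
    (q : Fin ρ.obj.unop.size) :
    ∃ i, ∃ a, Hom.toFun.{v} (ρ.r i).unop a = q := by
  classical
  by_contra! hq
  let T : SharpStr.{u} S n := ⟨2, Set.univ, fun M _ => M.mat.sharp_univ⟩
  let x : Hom.{v} ρ.obj.unop T := ⟨fun _ => (0 : Fin 2), fun _ _ => trivial⟩
  let y : Hom.{v} ρ.obj.unop T := ⟨fun q' => if q' = q then (1 : Fin 2) else 0, fun _ _ => trivial⟩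
  have hxy := ρ.jointly_mono (X := Opposite.op T) (Quiver.Hom.op x) (Quiver.Hom.op y) fun i =>
    Quiver.Hom.unop_inj <| hom_ext <| funext fun a => by
      change (0 : Fin 2) = if _ = q then (1 : Fin 2) else 0
      rw [if_neg (hq i a)]
  have := congrFun (congrArg Hom.toFun.{v} (Quiver.Hom.op_inj hxy)) q
  simp [x, y, T] at this

theorem hasClosedRelations_op {M : SizedMatr} (hMS : M ∈ S) (hM : ¬ IsTrivialMatr.{v, u} M) :
    HasClosedRelations.{v, u} (SharpStr.{u} S n)ᵒᵖ M := by
  intro A ρ X f hf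
  choose u hu using hf
  have hu' : ∀ j i a, Hom.toFun.{v} (f (M.mat i j)).unop a =
      Hom.toFun.{v} (u j).unop (Hom.toFun.{v} (ρ.r i).unop a) := fun j i a =>
    congrFun (congrArg (fun t => Hom.toFun.{v} t.unop) (hu j i)) a
  choose row pt hpt using exists_apply_eq ρ
  -- The value at q is forced by any representation of q as r i applied to a. A related tuple may
  -- use its rows in any order and with repetition, each with its own function; this is what
  -- sharpness of X covers.
  let v : Hom.{v} ρ.obj.unop X.unop :=
    ⟨fun q => Hom.toFun.{v} (f 0).unop (pt q), fun c hc => by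
      refine X.unop.sharp M hMS (fun l => M.mat (row (c l))) (fun l => ⟨_, rfl⟩)
        (fun l a => Hom.toFun.{v} (f a).unop (pt (c l))) fun j => ?_
      convert Hom.map_rel.{v} (u j).unop c hc using 1
      funext l
      exact (hu' j _ _).trans (congrArg _ (hpt _))⟩
  refine ⟨Quiver.Hom.op v, fun i => Quiver.Hom.unop_inj <| hom_ext <| funext fun a => ?_⟩
  -- Nontriviality makes the value independent of the chosen representation: the two rows agree in
  -- every column, through the u j.
  refine eq_zero_of_not_isTrivialMatr hM i (row (Hom.toFun.{v} (ρ.r i).unop a))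
    (fun b => Hom.toFun.{v} (f b).unop a) (fun b => Hom.toFun.{v} (f b).unop (pt _)) fun j => ?_
  exact (hu' j _ _).trans ((congrArg _ (hpt _).symm).trans (hu' j _ _).symm)

/-- The generic relation in the opposite category: the `n` elements of the structure freely
generated by a single related `n`-tuple. -/
def genericRel (S : MatrixSet) (n : ℕ) :
    InternalRel n (Opposite.op (free.{u} S 1 (∅ : Set (Fin n → Fin 1)))) where
  obj := Opposite.op (free.{u} S n {id})
  r i := Quiver.Hom.op (free.desc (fun _ => i) (fun _ hc => hc.elim) : Hom.{v} _ _)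
  jointly_mono _ _ h := Quiver.Hom.unop_inj <| hom_ext <| funext fun i =>
    congrFun (congrArg (fun t => Hom.toFun.{v} (Quiver.Hom.unop t)) (h i)) (0 : Fin 1)

/-- An element of a structure, as a morphism from the free structure on one element. -/
def point (A : SharpStr.{u} S n) (a : Fin A.size) :
    Opposite.op A ⟶ Opposite.op (free.{u} S 1 (∅ : Set (Fin n → Fin 1))) :=
  Quiver.Hom.op (free.desc (fun _ => a) (fun _ hc => hc.elim) : Hom.{v} _ _)

/-- A morphism out of the structure freely generated by one related n-tuple amounts to a related
n-tuple in the target. -/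
theorem factors_genericRel (A : SharpStr.{u} S n) (c : Fin n → Fin A.size) :
    (genericRel.{v} S n).Factors (fun i => point.{v} A (c i)) ↔ c ∈ A.rel := by
  constructor
  · rintro ⟨t, ht⟩
    have : c = Hom.toFun.{v} t.unop ∘ id := funext fun i =>
      congrFun (congrArg (fun t => Hom.toFun.{v} (Quiver.Hom.unop t)) (ht i)) (0 : Fin 1)
    rw [this]
    exact Hom.map_rel.{v} t.unop _ (subset_sharpClosure _ rfl)
  · intro hc
    exact ⟨Quiver.Hom.op (free.desc c (by rintro _ rfl; exact hc) : Hom.{v} _ _), fun i => rfl⟩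

end SharpStr

theorem sharpImpliesClosed_of_mclex_subset {S U : MatrixSet}
    (hS : ∀ M ∈ S, ¬ IsTrivialMatr.{v, u} M) (h : mclex.{v, u} S ⊆ mclex.{v, u} U) :
    SharpImpliesClosed.{w} S U := by
  intro n _ X R hR m k _ N hN f hf
  have hC : Cat.of (SharpStr.{u} S n)ᵒᵖ ∈ mclex.{v, u} S :=
    ⟨inferInstanceAs (HasFiniteLimits (SharpStr.{u} S n)ᵒᵖ),
      fun M hM => SharpStr.hasClosedRelations_op hM (hS M hM)⟩
  -- Only the pullback of R along f to the k entries of N matters, and there each entry is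
  -- interpreted by itself.
  let A : SharpStr.{u} S n := ⟨k, {c | f ∘ c ∈ R}, fun M hM => (hR M hM).preimage f⟩
  exact (SharpStr.factors_genericRel.{v} A _).1 <|
    (h hC).2 _ hN _ (SharpStr.genericRel.{v} S n) (Opposite.op A) (SharpStr.point.{v} A)
      fun j => (SharpStr.factors_genericRel.{v} A fun i => N i j).2 (hf j)

theorem mainTheorem1 (S U : MatrixSet) :
    (SharpImpliesClosed.{w} S U → mclex.{v, u} S ⊆ mclex.{v, u} U) ∧
    ((∀ M ∈ S, ¬ IsTrivialMatr.{v, u} M) →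
      mclex.{v, u} S ⊆ mclex.{v, u} U → SharpImpliesClosed.{w} S U) :=
  ⟨mclex_subset_of_sharpImpliesClosed, sharpImpliesClosed_of_mclex_subset⟩
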